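/- For a finite poset $U$ and $n\in\mathbb{N}=\{0,1,2,\dots\}$, a copy of $U$ in the powerset of $[n]=\{1,\dots,n\}$ is a set of subsets of $[n]$ which, ordered by inclusion, is order isomorphic to $U$. Two copies are unrelated if no member of either of them is contained in a member of the other. Let $\mathrm{Sp}(U,n)$ be the maximum $k$ such that there are $k$ pairwise unrelated copies of $U$ in the powerset of $[n]$. Let $r\ge 3$ and $0\le a<b\le r$ be integers with $a+2\le b$. Let $\mathrm{FSP}(r,a,b)$ be the poset $\{X\subseteq[r] : a<|X|<b\}$ ordered by inclusion, and let $J=\{0,\dots,a\}\cup\{b,\dots,r\}$. For $p\in\mathbb{Z}$ and integers $n\ge r$ put $$f^{(p)}_{rab}(n)=\sum_{i=0}^{\lfloor n/r\rfloor-1}\ \sum_{\substack{(v_j)_{j\in J}\in\mathbb{N}^{J}\\ \sum_{j\in J} v_j=i}} \frac{i!}{\prod_{j\in J}v_j!}\binom{n-(i+1)r}{p+\lfloor (n-r)/2\rfloor-\sum_{j\in J}jv_j}\prod_{j\in J}\binom{r}{j}^{v_j},$$ where $\binom{x}{y}=0$ unless $0\le y\le x$, and $$f_{rab}(n)=\max\{f^{(p)}_{rab}(n)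 : p\in\{-r,-r+1,\dots,r\}\}.$$ Then, as $n\to\infty$, $f_{rab}(n)\sim \mathrm{Sp}(\mathrm{FSP}(r,a,b),n)$ and, for every fixed $p\in\mathbb{Z}$, $f^{(p)}_{rab}(n)\sim \mathrm{Sp}(\mathrm{FSP}(r,a,b),n)$; that is, in both cases the ratio of the two sides tends to $1$. -/

import Mathlib

/-- A copy of the poset `U` in the powerset lattice of the `n`-element set `Fin n`: a set `C` of
subsets of `Fin n` which, ordered by inclusion, is order isomorphic to `U`. -/
def IsCopy (U : Type*) [PartialOrder U] {n : ℕ} (C : Finset (Finset (Fin n))) : Prop :=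
  Nonempty ({X : Finset (Fin n) // X ∈ C} ≃o U)

/-- Two families of subsets are unrelated if every member of the first one is incomparable with
every member of the second one. -/
def Unrelated {n : ℕ} (C D : Finset (Finset (Fin n))) : Prop :=
  ∀ X ∈ C, ∀ Y ∈ D, ¬ X ⊆ Y ∧ ¬ Y ⊆ X

/-- The numbers `k` such that there exist `k` pairwise unrelated copies of `U` in the powerset
lattice of an `n`-element set. -/
def spernerSet (U : Type*) [PartialOrder U] (n : ℕ) : Set ℕ :=
  {k | ∃ F : Finset (Finset (Finset (Fin n))), F.card = k ∧
    (∀ C ∈ F, IsCopy U C) ∧ ∀ C ∈ F, ∀ D ∈ F, C ≠ D → Unrelated C D}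

/-- `Sp U n`: the maximum number of pairwise unrelated copies of `U` in the powerset lattice of an
`n`-element set. -/
noncomputable def Sp (U : Type*) [PartialOrder U] (n : ℕ) : ℕ :=
  sSup (spernerSet U n)

/-- The supremum in the definition of `Sp` is always an attained maximum. -/
theorem isGreatest_Sp (U : Type*) [PartialOrder U] (n : ℕ) :
    IsGreatest (spernerSet U n) (Sp U n) := by
  have hb : BddAbove (spernerSet U n) := by
    refine ⟨Fintype.card (Finset (Finset (Fin n))), ?_⟩
    rintro k ⟨F, rfl, -, -⟩
    exact Finset.card_le_univ F
  have hne : (spernerSet U n).Nonempty := ⟨0, ∅, by simp⟩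
  exact ⟨Nat.sSup_mem hne hb, fun k hk => le_csSup hb hk⟩

/-- The full segment poset: the subsets `X` of an `r`-element set with `a < |X| < b`, ordered by
inclusion. -/
abbrev FSP (r a b : ℕ) : Type :=
  {X : Finset (Fin r) // a < X.card ∧ X.card < b}

/-- The binomial coefficient of two integers, with the convention that it is `0` unless
`0 ≤ y ≤ x`. -/
def intChoose (x y : ℤ) : ℕ :=
  if 0 ≤ y ∧ y ≤ x then x.toNat.choose y.toNat else 0

/-- The index set `{0, …, a} ∪ {b, …, r}`. -/
def extremalIndices (r a b : ℕ) : Finset ℕ :=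
  (Finset.range (r + 1)).filter fun j => j ≤ a ∨ b ≤ j

/-- The function `f^{(p)}_{rab}`. The inner sum runs over the vectors of natural numbers `v`
indexed by `{0, …, a} ∪ {b, …, r}` (extended by `0` outside this index set) whose components add
up to `i`; for such a `v`, `Nat.multinomial` is `i! / (v_0! ⋯ v_a! v_b! ⋯ v_r!)`. -/
def fp (p : ℤ) (r a b n : ℕ) : ℕ :=
  ∑ i ∈ Finset.range (n / r), ∑ v ∈ (extremalIndices r a b).piAntidiag i,
    Nat.multinomial (extremalIndices r a b) v *
      intChoose ((n : ℤ) - ((i : ℤ) + 1) * (r : ℤ))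
        (p + ((n : ℤ) - (r : ℤ)) / 2 - ∑ j ∈ extremalIndices r a b, (j : ℤ) * (v j : ℤ)) *
      ∏ j ∈ extremalIndices r a b, r.choose j ^ v j

/-- The function `f_{rab}`: the maximum of `f^{(p)}_{rab}` over `p ∈ {-r, …, r}`. -/
noncomputable def fmax (r a b n : ℕ) : ℕ :=
  (Finset.Icc (-(r : ℤ)) (r : ℤ)).sup fun p => fp p r a b n

/-! Let N be the size of `FSP r a b`, so N = 2^r - c with c the sum of C(r,j) over j in J, and let M
= C(n, ⌊n/2⌋). Both sides turn out to be asymptotic to M/N.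

Upper bound (`Sp_mul_card_le`): a numbering of [n] is a maximal chain of the powerset, and `prefixed
s` is the set of chains through s, at least n!/M of them. No chain meets two unrelated copies. Two
members of one copy share only an O(1/n) fraction of their chains, so a copy uses up at least (1 -
O(1/n)) N n!/M of the n! chains.

Lower bound (`fp_le_Sp`): cut off consecutive blocks B_0, B_1, ... of length r. For each i take all
sets S of one fixed size, disjoint from B_i, with |S ∩ B_l| in J for l < i; adding to S the subsets
of B_i of size strictly between a and b gives a copy. These copies are pairwise unrelated, and there
are exactly `fp p r a b n` of them.

For fixed i the i-th term of `fp` is asymptotic to c^i 2^(-(i+1)r) M, and the geometric series sums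
to M/N. Since `Sp` already bounds everything from above, finitely many terms suffice and no tail
estimate is needed. -/

/-! ### Upper bound by counting maximal chains -/

-- A chain through s and t is an ordering of s followed by an ordering of the complement of s that
-- begins with t \ s (the set `u` below).
open Finset Nat Numbering in
theorem card_prefixed_inter_prefixed_le {X : Type*} [Fintype X] [DecidableEq X] {s t : Finset X}
    (hst : s ⊆ t) :
    #(prefixed s ∩ prefixed t) ≤ (#s)! * ((#t - #s)! * (Fintype.card X - #t)!) := by
  classical
  let u : Finset ↥(sᶜ) := univ.filter fun x => (x : X) ∈ t
  have hu : #u = #t - #s := by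
    rw [← card_sdiff_of_subset hst]
    refine card_bij (fun x _ => (x : X)) ?_ ?_ ?_
    · intro x hx
      have := x.2
      simp only [u, mem_filter, mem_univ, true_and, mem_sdiff, mem_compl] at *
      exact ⟨hx, this⟩
    · intro x _ y _ h
      exact Subtype.ext h
    · intro x hx
      rw [mem_sdiff] at hx
      exact ⟨⟨x, mem_compl.2 hx.2⟩, by simp [u, hx.1], rfl⟩
  have hcard : #(univ ×ˢ prefixed u : Finset (Numbering s × Numbering ↥(sᶜ))) =
      (#s)! * ((#t - #s)! * (Fintype.card X - #t)!) := by
    have h1 : Fintype.card X - #s - (#t - #s) = Fintype.card X - #t := by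
      have := card_le_card hst
      omega
    rw [card_product, card_prefixed, hu, Finset.card_univ, Fintype.card_numbering,
      Fintype.card_coe, Fintype.card_coe, card_compl, h1]
  rw [← hcard]
  -- The `else` value is junk: only numberings in `prefixed s` matter.
  refine card_le_card_of_injOn
    (fun f => if hf : f ∈ prefixed s then prefixedEquiv s ⟨f, hf⟩ else
      (Fintype.equivFin _, Fintype.equivFin _)) ?_ ?_
  · intro f hf
    obtain ⟨hfs, hft⟩ := mem_inter.1 (mem_coe.1 hf)
    simp only [hfs, dite_true, coe_product, Set.mem_prod, mem_coe, mem_univ, true_and,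
      mem_prefixed]
    intro x
    have h1 := mem_prefixed.1 hft x
    have h2 := (mem_prefixed.1 hfs x).not.1 (mem_compl.1 x.2)
    have h3 : (((prefixedEquiv s ⟨f, hfs⟩).2 x : Fin _) : ℕ) = f x - #s := rfl
    have h4 : x ∈ u ↔ (x : X) ∈ t := by simp [u]
    rw [h3, hu, h4, h1]
    omega
  · intro f hf g hg h
    obtain ⟨hfs, -⟩ := mem_inter.1 (mem_coe.1 hf)
    obtain ⟨hgs, -⟩ := mem_inter.1 (mem_coe.1 hg)
    simp only [hfs, hgs, dite_true] at h
    exact congrArg Subtype.val ((prefixedEquiv s).injective h)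

-- Equivalent to k + l ≤ C(k + l, k).
open Nat in
theorem factorial_mul_factorial_mul_add_le {k l : ℕ} (hk : 0 < k) (hl : 0 < l) :
    k ! * l ! * (k + l) ≤ (k + l)! := by
  obtain ⟨k, rfl⟩ := Nat.exists_eq_add_one_of_ne_zero hk.ne'
  obtain ⟨l, rfl⟩ := Nat.exists_eq_add_one_of_ne_zero hl.ne'
  have key : (k + 1)! * (l + 1)! ≤ (k + l + 1)! := by
    clear hl
    induction l with
    | zero => simp
    | succ l ih =>
      rw [Nat.factorial_succ (l + 1), show k + (l + 1) + 1 = (k + l + 1) + 1 by ring,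
        Nat.factorial_succ (k + l + 1), mul_left_comm]
      exact Nat.mul_le_mul (by omega) ih
  rw [show k + 1 + (l + 1) = (k + l + 1) + 1 by ring, Nat.factorial_succ (k + l + 1), mul_comm]
  exact Nat.mul_le_mul_left _ key

open Finset Nat Numbering in
theorem mul_card_prefixed_inter_prefixed_le_of_ssubset {X : Type*} [Fintype X] [DecidableEq X]
    {s t : Finset X} (hst : s ⊂ t) (hs : s.Nonempty) (ht : t ≠ univ) :
    Fintype.card X * #(prefixed s ∩ prefixed t) ≤ 2 * (#(prefixed s) + #(prefixed t)) := by
  have hle := card_prefixed_inter_prefixed_le hst.subset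
  have h1 := card_lt_card hst
  have h2 : #t < Fintype.card X := card_lt_univ_of_notMem (Classical.not_forall.1
    (fun h => ht (eq_univ_iff_forall.2 h))).choose_spec
  have h3 := hs.card_pos
  rw [card_prefixed, card_prefixed]
  generalize #(prefixed s ∩ prefixed t) = c at *
  generalize Fintype.card X = n at *
  generalize #s = x at *
  generalize #t = y at *
  -- The chains through both sets are at most a fraction 1/(n - x) of those through s and at most
  -- 1/y of those through t; since x < y, one of n - x and y is at least n/2.
  by_cases hx : 2 * x ≤ n
  · have h := factorial_mul_factorial_mul_add_le (k := y - x) (l := n - y) (by omega) (by omega)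
    rw [show y - x + (n - y) = n - x by omega] at h
    calc n * c ≤ (2 * (n - x)) * (x ! * ((y - x)! * (n - y)!)) :=
          Nat.mul_le_mul (by omega) hle
      _ = 2 * (x ! * ((y - x)! * (n - y)! * (n - x))) := by ring
      _ ≤ 2 * (x ! * (n - x)!) := by gcongr
      _ ≤ _ := by omega
  · have h := factorial_mul_factorial_mul_add_le (k := x) (l := y - x) (by omega) (by omega)
    rw [show x + (y - x) = y by omega] at h
    calc n * c ≤ (2 * y) * (x ! * ((y - x)! * (n - y)!)) :=
          Nat.mul_le_mul (by omega) hle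
      _ = 2 * ((x ! * (y - x)! * y) * (n - y)!) := by ring
      _ ≤ 2 * (y ! * (n - y)!) := by gcongr
      _ ≤ _ := by omega

open Finset Nat Numbering in
theorem mul_card_prefixed_inter_prefixed_le {X : Type*} [Fintype X] [DecidableEq X]
    {s t : Finset X} (hst : s ≠ t) (hs : s.Nonempty) (hs' : s ≠ univ) (ht : t.Nonempty)
    (ht' : t ≠ univ) :
    Fintype.card X * #(prefixed s ∩ prefixed t) ≤ 2 * (#(prefixed s) + #(prefixed t)) := by
  by_cases h1 : s ⊆ t
  · exact mul_card_prefixed_inter_prefixed_le_of_ssubset (h1.ssubset_of_ne hst) hs ht'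
  by_cases h2 : t ⊆ s
  · have := mul_card_prefixed_inter_prefixed_le_of_ssubset (h2.ssubset_of_ne hst.symm) ht hs'
    rwa [inter_comm, add_comm]
  · rw [disjoint_iff_inter_eq_empty.1 (disjoint_prefixed_prefixed h1 h2)]
    simp

-- A Bonferroni inequality: the parts of the `A s` lying in no other `A t` are disjoint. Summing
-- over ordered pairs counts each intersection twice, which is harmless here.
open Finset in
theorem sum_card_le_card_biUnion_add {ι β : Type*} [DecidableEq ι] [DecidableEq β] (C : Finset ι)
    (A : ι → Finset β) :
    ∑ s ∈ C, #(A s) ≤ #(C.biUnion A) + ∑ s ∈ C, ∑ t ∈ C.erase s, #(A s ∩ A t) := by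
  have h1 : ∀ s ∈ C, #(A s) ≤ #(A s \ (C.erase s).biUnion A) +
      ∑ t ∈ C.erase s, #(A s ∩ A t) := by
    intro s _
    rw [← card_sdiff_add_card_inter (A s) ((C.erase s).biUnion A), inter_biUnion]
    gcongr
    exact card_biUnion_le
  refine (sum_le_sum h1).trans ?_
  rw [sum_add_distrib]
  gcongr
  rw [← card_biUnion]
  · exact card_le_card (biUnion_mono fun s _ => sdiff_subset)
  · intro s hs t ht hst
    rw [Function.onFun, disjoint_left]
    intro x hx hx'
    rw [mem_sdiff] at hx hx'
    exact hx'.2 (mem_biUnion.2 ⟨s, mem_erase.2 ⟨hst, hs⟩, hx.1⟩)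

open Finset Nat Numbering in
theorem mul_sum_card_prefixed_le {X : Type*} [Fintype X] [DecidableEq X]
    {C : Finset (Finset X)} (hC : ∅ ∉ C) (hC' : univ ∉ C) :
    Fintype.card X * ∑ s ∈ C, #(prefixed s) ≤
      Fintype.card X * #(C.biUnion prefixed) + 4 * #C * ∑ s ∈ C, #(prefixed s) := by
  have hne : ∀ s ∈ C, s.Nonempty := fun s hs => nonempty_iff_ne_empty.2 fun h => hC (h ▸ hs)
  have hnu : ∀ s ∈ C, s ≠ univ := fun s hs h => hC' (h ▸ hs)
  refine (Nat.mul_le_mul_left _ (sum_card_le_card_biUnion_add C prefixed)).trans ?_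
  rw [mul_add]
  refine Nat.add_le_add_left ?_ _
  calc Fintype.card X * ∑ s ∈ C, ∑ t ∈ C.erase s, #(prefixed s ∩ prefixed t)
      = ∑ s ∈ C, ∑ t ∈ C.erase s, Fintype.card X * #(prefixed s ∩ prefixed t) := by
        simp only [mul_sum]
    _ ≤ ∑ s ∈ C, ∑ t ∈ C.erase s, 2 * (#(prefixed s) + #(prefixed t)) := by
        refine sum_le_sum fun s hs => sum_le_sum fun t ht => ?_
        obtain ⟨hts, ht⟩ := mem_erase.1 ht
        exact mul_card_prefixed_inter_prefixed_le hts.symm (hne s hs) (hnu s hs) (hne t ht)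
          (hnu t ht)
    _ ≤ ∑ s ∈ C, ∑ t ∈ C, 2 * (#(prefixed s) + #(prefixed t)) :=
        sum_le_sum fun s _ => sum_le_sum_of_subset (erase_subset _ _)
    -- The factor 2 of the pair bound doubles because the two summands contribute equally.
    _ = 4 * #C * ∑ s ∈ C, #(prefixed s) := by
        simp only [← mul_sum, sum_add_distrib, sum_const, smul_eq_mul]
        ring

open Finset Nat Numbering in
theorem factorial_le_card_prefixed_mul_choose_middle {X : Type*} [Fintype X] [DecidableEq X]
    (s : Finset X) :
    (Fintype.card X)! ≤ #(prefixed s) * (Fintype.card X).choose (Fintype.card X / 2) := by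
  rw [card_prefixed, ← Nat.choose_mul_factorial_mul_factorial s.card_le_univ, mul_assoc, mul_comm]
  exact Nat.mul_le_mul_left _ (Nat.choose_le_middle _ _)

theorem IsCopy.card_eq {U : Type*} [PartialOrder U] [Fintype U] {n : ℕ}
    {C : Finset (Finset (Fin n))} (h : IsCopy U C) : C.card = Fintype.card U := by
  obtain ⟨e⟩ := h
  rw [← Fintype.card_coe]
  exact Fintype.card_congr e.toEquiv

open Finset in
theorem le_choose_middle (n : ℕ) : n ≤ n.choose (n / 2) := by
  simpa using Nat.choose_le_middle 1 n

open Finset Nat Numbering in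
theorem card_mul_card_le_of_unrelated {n N : ℕ} (hN : 0 < N)
    (F : Finset (Finset (Finset (Fin n)))) (hF : ∀ C ∈ F, #C = N)
    (hF' : ∀ C ∈ F, ∀ D ∈ F, C ≠ D → Unrelated C D) :
    (n - 4 * N) * (#F * N) ≤ n * n.choose (n / 2) := by
  rcases le_or_gt n (4 * N) with hn | hn
  · simp [Nat.sub_eq_zero_of_le hn]
  have hne : ∀ C ∈ F, C.Nonempty := fun C hC => card_pos.1 (hF C hC ▸ hN)
  -- A member ∅ or `univ` is comparable to every set, so its copy is alone in `F` and a crude bound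
  -- suffices.
  by_cases hbad : ∃ C ∈ F, ∅ ∈ C ∨ univ ∈ C
  · obtain ⟨C, hC, h⟩ := hbad
    have hone : #F ≤ 1 := by
      rw [card_le_one_iff_subset_singleton]
      refine ⟨C, fun D hD => ?_⟩
      rw [mem_singleton]
      by_contra hDC
      obtain ⟨Y, hY⟩ := hne D hD
      have hu := hF' D hD C hC hDC Y hY
      rcases h with h | h
      · exact (hu _ h).2 (empty_subset _)
      · exact (hu _ h).1 (subset_univ _)
    calc (n - 4 * N) * (#F * N) ≤ n * (1 * n) := by gcongr <;> omega
      _ ≤ _ := by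
        rw [one_mul]
        exact Nat.mul_le_mul_left _ (le_choose_middle n)
  push Not at hbad
  set T := ∑ C ∈ F, ∑ s ∈ C, #(prefixed s) with hT
  have hunion : ∑ C ∈ F, #(C.biUnion prefixed) ≤ n ! := by
    rw [← card_biUnion]
    · refine (card_le_univ _).trans_eq ?_
      rw [Fintype.card_numbering, Fintype.card_fin]
    · intro C hC D hD hCD
      rw [Function.onFun, disjoint_biUnion_left]
      intro s hs
      rw [disjoint_biUnion_right]
      intro t ht
      obtain ⟨h1, h2⟩ := hF' C hC D hD hCD s hs t ht
      exact disjoint_prefixed_prefixed h1 h2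
  have hup : n * T ≤ n * n ! + 4 * N * T := by
    calc n * T = ∑ C ∈ F, n * ∑ s ∈ C, #(prefixed s) := by rw [hT, mul_sum]
      _ ≤ ∑ C ∈ F, (n * #(C.biUnion prefixed) + 4 * N * ∑ s ∈ C, #(prefixed s)) := by
        refine sum_le_sum fun C hC => ?_
        have := mul_sum_card_prefixed_le (hbad C hC).1 (hbad C hC).2
        rw [hF C hC] at this
        simpa only [Fintype.card_fin] using this
      _ = n * ∑ C ∈ F, #(C.biUnion prefixed) + 4 * N * T := by
        rw [sum_add_distrib, mul_sum, mul_sum]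
      _ ≤ _ := by gcongr
  have hlow : #F * N * n ! ≤ T * n.choose (n / 2) := by
    rw [hT, sum_mul]
    calc #F * N * n ! = ∑ C ∈ F, ∑ s ∈ C, n ! := by
          rw [sum_congr rfl fun C hC => by rw [sum_const, hF C hC]]
          simp [mul_assoc]
      _ ≤ _ := by
        refine sum_le_sum fun C _ => ?_
        rw [sum_mul]
        refine sum_le_sum fun s _ => ?_
        simpa using factorial_le_card_prefixed_mul_choose_middle s
  have hup' : (n - 4 * N) * T ≤ n * n ! := by
    rw [Nat.sub_mul]
    omega
  refine Nat.le_of_mul_le_mul_right ?_ (Nat.factorial_pos n)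
  calc (n - 4 * N) * (#F * N) * n ! = (n - 4 * N) * (#F * N * n !) := by ring
    _ ≤ (n - 4 * N) * (T * n.choose (n / 2)) := by gcongr
    _ = (n - 4 * N) * T * n.choose (n / 2) := by ring
    _ ≤ n * n ! * n.choose (n / 2) := by gcongr
    _ = _ := by ring

theorem Sp_mul_card_le (U : Type*) [PartialOrder U] [Fintype U] [Nonempty U] (n : ℕ) :
    (n - 4 * Fintype.card U) * (Sp U n * Fintype.card U) ≤ n * n.choose (n / 2) := by
  obtain ⟨F, hF, hcopy, hunrel⟩ := (isGreatest_Sp U n).1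
  rw [← hF]
  exact card_mul_card_le_of_unrelated Fintype.card_pos F (fun C hC => (hcopy C hC).card_eq) hunrel

/-! ### Counting the block families -/

/-- The subsets of `B 0 ∪ ⋯ ∪ B (i - 1) ∪ W` of size `c` that meet every block `B l` with `l < i`
in a set whose size belongs to `J`. -/
def blockFamily {α : Type*} [DecidableEq α] (J : Finset ℕ) (B : ℕ → Finset α) (W : Finset α)
    (i : ℕ) (c : ℤ) : Finset (Finset α) :=
  ((Finset.range i).biUnion B ∪ W).powerset.filter fun S =>
    (S.card : ℤ) = c ∧ ∀ l < i, (S ∩ B l).card ∈ J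

open Finset in
theorem mem_blockFamily {α : Type*} [DecidableEq α] {J : Finset ℕ} {B : ℕ → Finset α}
    {W : Finset α} {i : ℕ} {c : ℤ} {S : Finset α} :
    S ∈ blockFamily J B W i c ↔
      S ⊆ (range i).biUnion B ∪ W ∧ (#S : ℤ) = c ∧ ∀ l < i, #(S ∩ B l) ∈ J := by
  rw [blockFamily, mem_filter, mem_powerset]

open Finset in
theorem card_blockFamily_zero {α : Type*} [DecidableEq α] (J : Finset ℕ) (B : ℕ → Finset α)
    (W : Finset α) (c : ℤ) : #(blockFamily J B W 0 c) = intChoose #W c := by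
  rw [intChoose]
  split_ifs with h
  · obtain ⟨k, rfl⟩ := Int.eq_ofNat_of_zero_le h.1
    rw [Int.toNat_natCast, Int.toNat_natCast, ← card_powersetCard]
    congr 1
    ext S
    simp [mem_blockFamily, mem_powersetCard]
  · rw [card_eq_zero, eq_empty_iff_forall_notMem]
    intro S hS
    rw [mem_blockFamily] at hS
    have := card_le_card hS.1
    simp only [range_zero, biUnion_empty, empty_union] at this
    omega

-- Sort by T = S ∩ B i: there are C(r,j) sets T of size j, and S \ B i ranges over the family for i
-- with size c - j.
open Finset in
theorem card_blockFamily_succ {α : Type*} [DecidableEq α] {J : Finset ℕ} {B : ℕ → Finset α}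
    {W : Finset α} {i r : ℕ} (hB : #(B i) = r) (hBB : ∀ l < i, Disjoint (B l) (B i))
    (hBW : Disjoint W (B i)) (c : ℤ) :
    #(blockFamily J B W (i + 1) c) = ∑ j ∈ J, r.choose j * #(blockFamily J B W i (c - j)) := by
  have hdisj : Disjoint ((range i).biUnion B ∪ W) (B i) := by
    rw [disjoint_union_left, disjoint_biUnion_left]
    exact ⟨fun l hl => hBB l (mem_range.1 hl), hBW⟩
  have hmaps : Set.MapsTo (fun S => S ∩ B i) (blockFamily J B W (i + 1) c : Set (Finset α))
      (J.biUnion fun j => powersetCard j (B i) : Finset (Finset α)) := by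
    intro S hS
    rw [mem_coe, mem_blockFamily] at hS
    rw [mem_coe, mem_biUnion]
    exact ⟨_, hS.2.2 i (Nat.lt_succ_self i), mem_powersetCard.2 ⟨inter_subset_right, rfl⟩⟩
  rw [card_eq_sum_card_fiberwise hmaps, sum_biUnion]
  · refine sum_congr rfl fun j hj => ?_
    rw [← hB, ← card_powersetCard, ← smul_eq_mul, ← sum_const]
    refine sum_congr rfl fun T hT => ?_
    obtain ⟨hTB, hTj⟩ := mem_powersetCard.1 hT
    refine card_nbij' (fun S => S \ B i) (fun S => S ∪ T) ?_ ?_ ?_ ?_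
    · intro S hS
      simp only [coe_filter, Set.mem_ofPred_eq, mem_blockFamily, mem_coe] at hS ⊢
      obtain ⟨⟨h1, h2, h3⟩, h4⟩ := hS
      refine ⟨?_, ?_, fun l hl => ?_⟩
      · intro x hx
        rw [mem_sdiff] at hx
        have := h1 hx.1
        rw [range_add_one, biUnion_insert, union_assoc, mem_union] at this
        exact this.resolve_left hx.2
      · have := card_sdiff_add_card_inter S (B i)
        rw [h4, hTj] at this
        omega
      · convert h3 l (by omega) using 2
        ext x
        simp only [mem_inter, mem_sdiff]
        have : x ∈ B l → x ∉ B i := fun h => disjoint_left.1 (hBB l hl) h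
        tauto
    · intro S hS
      simp only [coe_filter, Set.mem_ofPred_eq, mem_blockFamily, mem_coe] at hS ⊢
      obtain ⟨h1, h2, h3⟩ := hS
      have hSB : Disjoint S (B i) := hdisj.mono_left h1
      have h4 : (S ∪ T) ∩ B i = T := by
        rw [union_inter_distrib_right, disjoint_iff_inter_eq_empty.1 hSB, empty_union,
          inter_eq_left.2 hTB]
      refine ⟨⟨?_, ?_, fun l hl => ?_⟩, h4⟩
      · rw [range_add_one, biUnion_insert, union_assoc, union_comm]
        exact union_subset_union hTB h1
      · rw [card_union_of_disjoint (hSB.mono_right hTB)]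
        push_cast
        omega
      · rcases Nat.lt_succ_iff_lt_or_eq.1 hl with hl | rfl
        · have : T ∩ B l = ∅ :=
            disjoint_iff_inter_eq_empty.1 ((hBB l hl).symm.mono_left hTB)
          rw [union_inter_distrib_right, this, union_empty]
          exact h3 l hl
        · rwa [h4, hTj]
    · intro S hS
      simp only [coe_filter, Set.mem_ofPred_eq] at hS
      change S \ B i ∪ T = S
      rw [← hS.2, sdiff_union_inter]
    · intro S hS
      rw [mem_coe, mem_blockFamily] at hS
      change (S ∪ T) \ B i = S
      rw [union_sdiff_distrib, sdiff_eq_empty_iff_subset.2 hTB, union_empty,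
        sdiff_eq_self_of_disjoint (hdisj.mono_left hS.1)]
  · intro j _ j' _ hjj
    exact pairwise_disjoint_powersetCard _ hjj

/-- The linear functional on polynomials sending `X ^ m` to the number of subsets of size `c - m`
of a set of size `w`. -/
noncomputable def chooseFunctional (w : ℕ) (c : ℤ) : Polynomial ℕ →ₗ[ℕ] ℕ :=
  Polynomial.lsum fun m => intChoose w (c - m) • LinearMap.id

open Polynomial in
theorem chooseFunctional_monomial (w : ℕ) (c : ℤ) (m k : ℕ) :
    chooseFunctional w c (monomial m k) = k * intChoose w (c - m) := by
  simp [chooseFunctional, Polynomial.lsum_apply, Polynomial.sum_monomial_index, mul_comm]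

open Polynomial in
theorem chooseFunctional_monomial_mul (w : ℕ) (c : ℤ) (m k : ℕ) (Q : ℕ[X]) :
    chooseFunctional w c (monomial m k * Q) = k * chooseFunctional w (c - m) Q := by
  induction Q using Polynomial.induction_on' with
  | add p q hp hq => rw [mul_add, map_add, map_add, hp, hq, mul_add]
  | monomial j l =>
    rw [monomial_mul_monomial, chooseFunctional_monomial, chooseFunctional_monomial, mul_assoc]
    push_cast
    rw [sub_sub]

-- Under the functional, multiplication by X^j is the shift of c to c - j, so the recursion in i
-- becomes multiplication by a fixed polynomial. The multinomial theorem then expands its power into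
-- the inner sum of `fp`.
open Finset Polynomial in
theorem card_blockFamily {α : Type*} [DecidableEq α] {J : Finset ℕ} {B : ℕ → Finset α}
    {W : Finset α} {r : ℕ} (i : ℕ) (hB : ∀ l < i, #(B l) = r)
    (hBB : ∀ k < i, ∀ l < k, Disjoint (B l) (B k)) (hBW : ∀ l < i, Disjoint W (B l)) (c : ℤ) :
    #(blockFamily J B W i c) =
      chooseFunctional #W c ((∑ j ∈ J, monomial j (r.choose j)) ^ i) := by
  induction i generalizing c with
  | zero =>
    rw [card_blockFamily_zero, pow_zero, ← monomial_zero_one, chooseFunctional_monomial]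
    simp
  | succ i ih =>
    rw [card_blockFamily_succ (hB i (by omega)) (hBB i (by omega)) (hBW i (by omega)), pow_succ',
      sum_mul, map_sum]
    refine sum_congr rfl fun j _ => ?_
    rw [chooseFunctional_monomial_mul, ih (fun l hl => hB l (by omega))
      (fun k hk => hBB k (by omega)) fun l hl => hBW l (by omega)]

open Finset Polynomial in
theorem chooseFunctional_pow (w r i : ℕ) (c : ℤ) (J : Finset ℕ) :
    chooseFunctional w c ((∑ j ∈ J, monomial j (r.choose j)) ^ i) =
      ∑ v ∈ J.piAntidiag i, Nat.multinomial J v *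
        intChoose w (c - ∑ j ∈ J, (j : ℤ) * (v j : ℤ)) * ∏ j ∈ J, r.choose j ^ v j := by
  rw [sum_pow_eq_sum_piAntidiag, map_sum]
  refine sum_congr rfl fun v hv => ?_
  clear hv
  have h : (Nat.multinomial J v : ℕ[X]) * ∏ j ∈ J, monomial j (r.choose j) ^ v j =
      monomial (∑ j ∈ J, j * v j) (Nat.multinomial J v * ∏ j ∈ J, r.choose j ^ v j) := by
    simp only [monomial_pow]
    rw [← nsmul_eq_mul, ← smul_eq_mul (a := Nat.multinomial J v), ← smul_monomial]
    congr 1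
    induction J using Finset.induction_on with
    | empty => simp
    | insert a s ha ih =>
      rw [prod_insert ha, prod_insert ha, sum_insert ha, ih, monomial_mul_monomial]
  rw [h, chooseFunctional_monomial]
  push_cast
  ring

/-! ### The copies and their unrelatedness -/

/-- The sets obtained from `S` by adding a subset of `B` of size strictly between `a` and `b`. -/
def fspCopy {α : Type*} [DecidableEq α] (a b : ℕ) (B S : Finset α) : Finset (Finset α) :=
  (B.powerset.filter fun T => a < T.card ∧ T.card < b).image fun T => S ∪ T

open Finset in
theorem sdiff_eq_and_card_inter_of_mem_fspCopy {α : Type*} [DecidableEq α] {a b : ℕ}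
    {B S Z : Finset α} (hSB : Disjoint S B) (hZ : Z ∈ fspCopy a b B S) :
    Z \ B = S ∧ a < #(Z ∩ B) ∧ #(Z ∩ B) < b := by
  rw [fspCopy, mem_image] at hZ
  obtain ⟨T, hT, rfl⟩ := hZ
  rw [mem_filter, mem_powerset] at hT
  rw [union_sdiff_distrib, sdiff_eq_empty_iff_subset.2 hT.1, union_empty,
    sdiff_eq_self_of_disjoint hSB, union_inter_distrib_right,
    disjoint_iff_inter_eq_empty.1 hSB, empty_union, inter_eq_left.2 hT.1]
  exact ⟨rfl, hT.2⟩

open Finset in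
theorem isCopy_fspCopy {n r a b : ℕ} {B S : Finset (Fin n)} (hB : #B = r) (hSB : Disjoint S B) :
    IsCopy (FSP r a b) (fspCopy a b B S) := by
  let e : Fin r ↪ Fin n := (B.orderEmbOfFin hB).toEmbedding
  have he : univ.map e = B := B.map_orderEmbOfFin_univ hB
  have hmem : ∀ X : FSP r a b, S ∪ X.1.map e ∈ fspCopy a b B S := by
    intro X
    refine mem_image_of_mem _ (mem_filter.2 ⟨mem_powerset.2 ?_, ?_⟩)
    · rw [← he]
      exact map_subset_map.2 (subset_univ _)
    · rw [card_map]
      exact X.2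
  have hle : ∀ X Y : FSP r a b, S ∪ X.1.map e ⊆ S ∪ Y.1.map e ↔ X ≤ Y := by
    intro X Y
    refine ⟨fun h => ?_, fun h => union_subset_union_right (map_subset_map.2 h)⟩
    rw [← Subtype.coe_le_coe, ← map_subset_map (f := e)]
    intro x hx
    refine (mem_union.1 (h (mem_union_right _ hx))).resolve_left fun hxS => ?_
    exact disjoint_left.1 hSB hxS (he ▸ map_subset_map.2 (subset_univ X.1) hx)
  let g : FSP r a b ↪o {X : Finset (Fin n) // X ∈ fspCopy a b B S} :=
    OrderEmbedding.ofMapLEIff (fun X => ⟨S ∪ X.1.map e, hmem X⟩) fun X Y => hle X Y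
  have hg : Function.Surjective g := by
    rintro ⟨Z, hZ⟩
    have hZ' := hZ
    rw [fspCopy, mem_image] at hZ'
    obtain ⟨T, hT, rfl⟩ := hZ'
    rw [mem_filter, mem_powerset, ← he] at hT
    obtain ⟨X, -, rfl⟩ := subset_map_iff.1 hT.1
    exact ⟨⟨X, by simpa using hT.2⟩, rfl⟩
  exact ⟨(OrderIso.ofSurjective g hg).symm⟩

-- If Z ⊆ Z', then |Z' ∩ B| > a, hence ≥ b, and |Z' \ B| ≥ c, so |Z'| ≥ c + b; but |Z'| = c + |Z' ∩
-- B'| < c + b. The other inclusion similarly gives |Z'| ≤ c + a against |Z'| > c + a.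
open Finset in
theorem not_subset_and_not_subset_of_blocks {α : Type*} [DecidableEq α] {a b c : ℕ}
    {B B' Z Z' : Finset α} (hc : #(Z \ B) = c) (ha : a < #(Z ∩ B)) (hb : #(Z ∩ B) < b)
    (hc' : #(Z' \ B') = c) (ha' : a < #(Z' ∩ B')) (hb' : #(Z' ∩ B') < b)
    (h : #(Z' ∩ B) ≤ a ∨ b ≤ #(Z' ∩ B)) : ¬ Z ⊆ Z' ∧ ¬ Z' ⊆ Z := by
  have e1 := card_sdiff_add_card_inter Z' B
  have e2 := card_sdiff_add_card_inter Z' B'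
  constructor
  · intro hs
    have h1 := card_le_card (inter_subset_inter_right (u := B) hs)
    have h2 := card_le_card (sdiff_subset_sdiff hs (Subset.refl B))
    omega
  · intro hs
    have h1 := card_le_card (inter_subset_inter_right (u := B) hs)
    have h2 := card_le_card (sdiff_subset_sdiff hs (Subset.refl B))
    omega

/-- The `i`-th interval of length `r` in `Fin n`. -/
def finBlock (r n i : ℕ) : Finset (Fin n) :=
  Finset.univ.filter fun x => i * r ≤ x.val ∧ x.val < (i + 1) * r

open Finset in
theorem card_filter_fin_val {n l m : ℕ} (hm : m ≤ n) :
    #(univ.filter fun x : Fin n => l ≤ x.val ∧ x.val < m) = m - l := by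
  rw [← Nat.card_Ico, ← card_map Fin.valEmbedding]
  congr 1
  ext x
  simp only [mem_map, mem_filter, mem_univ, true_and, Fin.valEmbedding_apply, mem_Ico]
  constructor
  · rintro ⟨y, hy, rfl⟩
    exact hy
  · intro hx
    exact ⟨⟨x, by omega⟩, hx, rfl⟩

open Finset in
theorem card_finBlock {r n i : ℕ} (hi : i < n / r) : #(finBlock r n i) = r := by
  have h : (i + 1) * r ≤ n :=
    (Nat.mul_le_mul_right r hi).trans (Nat.div_mul_le_self n r)
  rw [finBlock, card_filter_fin_val h, add_mul, one_mul, Nat.add_sub_cancel_left]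

theorem disjoint_finBlock (r n : ℕ) {i j : ℕ} (hij : i < j) :
    Disjoint (finBlock r n i) (finBlock r n j) := by
  rw [Finset.disjoint_left]
  intro x hx hx'
  simp only [finBlock, Finset.mem_filter, Finset.mem_univ, true_and] at hx hx'
  have := Nat.mul_le_mul_right r (show i + 1 ≤ j from hij)
  omega

/-- The elements of `Fin n` that are at least `(i + 1) * r`. -/
def finTail (r n i : ℕ) : Finset (Fin n) :=
  Finset.univ.filter fun x => (i + 1) * r ≤ x.val ∧ x.val < n

theorem disjoint_finTail_finBlock (r n : ℕ) {i l : ℕ} (hl : l ≤ i) :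
    Disjoint (finTail r n i) (finBlock r n l) := by
  rw [Finset.disjoint_left]
  intro x hx hx'
  simp only [finTail, finBlock, Finset.mem_filter, Finset.mem_univ, true_and] at hx hx'
  have := Nat.mul_le_mul_right r (show l + 1 ≤ i + 1 by omega)
  omega

open Finset in
theorem disjoint_of_mem_blockFamily {r n i : ℕ} {J : Finset ℕ} {c : ℤ} {S : Finset (Fin n)}
    (hS : S ∈ blockFamily J (finBlock r n) (finTail r n i) i c) :
    Disjoint S (finBlock r n i) := by
  refine Disjoint.mono_left (mem_blockFamily.1 hS).1 ?_
  rw [disjoint_union_left, disjoint_biUnion_left]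
  exact ⟨fun l hl => disjoint_finBlock r n (mem_range.1 hl),
    disjoint_finTail_finBlock r n le_rfl⟩

theorem mem_extremalIndices {r a b j : ℕ} :
    j ∈ extremalIndices r a b ↔ j < r + 1 ∧ (j ≤ a ∨ b ≤ j) := by
  simp [extremalIndices]

theorem Unrelated.symm {n : ℕ} {C D : Finset (Finset (Fin n))} (h : Unrelated C D) :
    Unrelated D C := fun X hX Y hY => (h Y hY X hX).symm

open Finset in
theorem unrelated_fspCopy_of_lt {r n a b i i' : ℕ} {c : ℤ} {S S' : Finset (Fin n)}
    (hS : S ∈ blockFamily (extremalIndices r a b) (finBlock r n) (finTail r n i) i c)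
    (hS' : S' ∈ blockFamily (extremalIndices r a b) (finBlock r n) (finTail r n i') i' c)
    (hi : i < i') :
    Unrelated (fspCopy a b (finBlock r n i) S) (fspCopy a b (finBlock r n i') S') := by
  intro Z hZ Z' hZ'
  obtain ⟨h1, h2, h3⟩ := sdiff_eq_and_card_inter_of_mem_fspCopy (disjoint_of_mem_blockFamily hS) hZ
  obtain ⟨h1', h2', h3'⟩ :=
    sdiff_eq_and_card_inter_of_mem_fspCopy (disjoint_of_mem_blockFamily hS') hZ'
  obtain ⟨-, hc, -⟩ := mem_blockFamily.1 hS
  obtain ⟨-, hc', hJ⟩ := mem_blockFamily.1 hS'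
  refine not_subset_and_not_subset_of_blocks (c := #S) (by rw [h1]) h2 h3
    (by rw [h1']; omega) h2' h3' ?_
  -- Z' differs from S' only inside block i', so its trace on the earlier block i has size in J.
  have h4 : Z' ∩ finBlock r n i = S' ∩ finBlock r n i := by
    rw [← h1']
    ext x
    have : x ∈ finBlock r n i → x ∉ finBlock r n i' :=
      fun h => disjoint_left.1 (disjoint_finBlock r n hi) h
    simp only [mem_inter, mem_sdiff]
    tauto
  rw [h4]
  exact (mem_extremalIndices.1 (hJ i hi)).2

open Finset in
theorem unrelated_fspCopy_of_ne {r n a b i : ℕ} {J : Finset ℕ} {c : ℤ} {S S' : Finset (Fin n)}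
    (hS : S ∈ blockFamily J (finBlock r n) (finTail r n i) i c)
    (hS' : S' ∈ blockFamily J (finBlock r n) (finTail r n i) i c) (hSS' : S ≠ S') :
    Unrelated (fspCopy a b (finBlock r n i) S) (fspCopy a b (finBlock r n i) S') := by
  intro Z hZ Z' hZ'
  obtain ⟨h1, -⟩ := sdiff_eq_and_card_inter_of_mem_fspCopy (disjoint_of_mem_blockFamily hS) hZ
  obtain ⟨h1', -⟩ := sdiff_eq_and_card_inter_of_mem_fspCopy (disjoint_of_mem_blockFamily hS') hZ'
  obtain ⟨-, hc, -⟩ := mem_blockFamily.1 hS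
  obtain ⟨-, hc', -⟩ := mem_blockFamily.1 hS'
  constructor
  · intro h
    have := sdiff_subset_sdiff h (Subset.refl (finBlock r n i))
    rw [h1, h1'] at this
    exact hSS' (eq_of_subset_of_card_le this (by omega))
  · intro h
    have := sdiff_subset_sdiff h (Subset.refl (finBlock r n i))
    rw [h1, h1'] at this
    exact hSS' (eq_of_subset_of_card_le this (by omega)).symm

open Finset in
theorem IsCopy.nonempty {U : Type*} [PartialOrder U] [Nonempty U] {n : ℕ}
    {C : Finset (Finset (Fin n))} (h : IsCopy U C) : C.Nonempty := by
  obtain ⟨e⟩ := h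
  exact ⟨_, (e.symm (Classical.arbitrary U)).2⟩

open Finset in
theorem not_unrelated_self {n : ℕ} {C : Finset (Finset (Fin n))} (h : C.Nonempty) :
    ¬ Unrelated C C := by
  obtain ⟨X, hX⟩ := h
  exact fun hC => (hC X hX X hX).1 (Subset.refl X)

theorem nonempty_FSP {r a b : ℕ} (hab : a + 2 ≤ b) (hbr : b ≤ r) : Nonempty (FSP r a b) := by
  obtain ⟨X, -, hX⟩ := Finset.exists_subset_card_eq (s := (Finset.univ : Finset (Fin r)))
    (n := a + 1) (by rw [Finset.card_univ, Fintype.card_fin]; omega)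
  exact ⟨⟨X, by omega⟩⟩

open Finset in
theorem fp_le_Sp {r a b : ℕ} (hab : a + 2 ≤ b) (hbr : b ≤ r) (p : ℤ) (n : ℕ) :
    fp p r a b n ≤ Sp (FSP r a b) n := by
  have := nonempty_FSP hab hbr
  set J := extremalIndices r a b
  -- The size of S does not depend on i; copies from different blocks are unrelated only because of
  -- this.
  set c : ℤ := p + ((n : ℤ) - (r : ℤ)) / 2
  let I : Finset (Σ _ : ℕ, Finset (Fin n)) :=
    (range (n / r)).sigma fun i => blockFamily J (finBlock r n) (finTail r n i) i c
  let copy : (Σ _ : ℕ, Finset (Fin n)) → Finset (Finset (Fin n)) :=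
    fun q => fspCopy a b (finBlock r n q.1) q.2
  have hcopy : ∀ q ∈ I, IsCopy (FSP r a b) (copy q) := by
    rintro ⟨i, S⟩ hq
    rw [mem_sigma, mem_range] at hq
    exact isCopy_fspCopy (card_finBlock hq.1) (disjoint_of_mem_blockFamily hq.2)
  have hunrel : ∀ q ∈ I, ∀ q' ∈ I, q ≠ q' → Unrelated (copy q) (copy q') := by
    rintro ⟨i, S⟩ hq ⟨i', S'⟩ hq' hne
    rw [mem_sigma, mem_range] at hq hq'
    rcases lt_trichotomy i i' with h | rfl | h
    · exact unrelated_fspCopy_of_lt hq.2 hq'.2 h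
    · exact unrelated_fspCopy_of_ne hq.2 hq'.2 fun h => hne (Sigma.ext rfl (heq_of_eq h))
    · exact (unrelated_fspCopy_of_lt hq'.2 hq.2 h).symm
  -- Equal copies with different indices would be unrelated to themselves, which a nonempty family
  -- cannot be.
  have hinj : Set.InjOn copy I := by
    intro q hq q' hq' h
    by_contra hne
    have h1 := hunrel q hq q' hq' hne
    rw [h] at h1
    exact not_unrelated_self (hcopy q' hq').nonempty h1
  have hcard : #(I.image copy) = fp p r a b n := by
    rw [card_image_of_injOn hinj, card_sigma, fp]
    refine sum_congr rfl fun i hi => ?_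
    rw [mem_range] at hi
    have htail : #(finTail r n i) = n - (i + 1) * r := card_filter_fin_val le_rfl
    have hle : (i + 1) * r ≤ n :=
      (Nat.mul_le_mul_right r hi).trans (Nat.div_mul_le_self n r)
    rw [card_blockFamily (r := r) i (fun l hl => card_finBlock (hl.trans hi))
      (fun k _ l hl => disjoint_finBlock r n hl)
      (fun l hl => disjoint_finTail_finBlock r n hl.le), chooseFunctional_pow, htail]
    push_cast [hle]
    rfl
  rw [← hcard]
  refine (isGreatest_Sp (FSP r a b) n).2 ⟨I.image copy, rfl, ?_, ?_⟩
  · intro C hC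
    obtain ⟨q, hq, rfl⟩ := mem_image.1 hC
    exact hcopy q hq
  · intro C hC D hD hCD
    obtain ⟨q, hq, rfl⟩ := mem_image.1 hC
    obtain ⟨q', hq', rfl⟩ := mem_image.1 hD
    exact hunrel q hq q' hq' fun h => hCD (by rw [h])

/-! ### Binomial coefficients near the middle -/

theorem intChoose_natCast (n k : ℕ) : intChoose n k = n.choose k := by
  rw [intChoose]
  split_ifs with h
  · simp
  · rw [Nat.choose_eq_zero_of_lt (by omega)]

theorem intChoose_of_neg {x y : ℤ} (hy : y < 0) : intChoose x y = 0 := by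
  rw [intChoose, if_neg (by omega)]

theorem intChoose_add_one_mul {x y : ℤ} (hx : 0 ≤ x) (hy : 0 ≤ y) :
    (intChoose x (y + 1) : ℤ) * (y + 1) = intChoose x y * (x - y) := by
  lift x to ℕ using hx
  lift y to ℕ using hy
  rcases le_or_gt y x with h | h
  · have := Nat.choose_succ_right_eq x y
    have h1 : intChoose x ((y : ℤ) + 1) = x.choose (y + 1) := intChoose_natCast x (y + 1)
    rw [h1, intChoose_natCast]
    zify [h] at this
    exact this
  · have h1 : intChoose x ((y : ℤ) + 1) = x.choose (y + 1) := intChoose_natCast x (y + 1)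
    rw [h1, intChoose_natCast, Nat.choose_eq_zero_of_lt h, Nat.choose_eq_zero_of_lt (by omega)]
    simp

theorem intChoose_sub_one_mul {x y : ℤ} (hx : 1 ≤ x) :
    (intChoose (x - 1) y : ℤ) * x = intChoose x y * (x - y) := by
  rcases lt_or_ge y 0 with hy | hy
  · simp [intChoose_of_neg hy]
  obtain ⟨x, rfl⟩ : ∃ k : ℕ, x = (k + 1 : ℕ) := ⟨(x - 1).toNat, by omega⟩
  lift y to ℕ using hy
  have h1 : (((x + 1 : ℕ) : ℤ) - 1) = (x : ℤ) := by push_cast; ring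
  rw [h1, intChoose_natCast, intChoose_natCast]
  rcases le_or_gt y (x + 1) with h | h
  · have := Nat.choose_mul_succ_eq x y
    zify [h] at this
    push_cast
    exact this
  · rw [Nat.choose_eq_zero_of_lt h, Nat.choose_eq_zero_of_lt (by omega)]
    simp

open Filter Topology in
theorem tendsto_int_half_div : Tendsto (fun n : ℕ => (((n : ℤ) / 2 : ℤ) : ℝ) / n) atTop
    (𝓝 (1 / 2)) := by
  have h : Tendsto (fun n : ℕ => (1 : ℝ) / 2 - 1 / 2 * (1 / (n : ℝ))) atTop (𝓝 (1 / 2)) := by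
    have := ((tendsto_one_div_atTop_nhds_zero_nat (𝕜 := ℝ)).const_mul (1 / 2)).const_sub (1 / 2)
    rwa [mul_zero, sub_zero] at this
  refine tendsto_of_tendsto_of_tendsto_of_le_of_le' h tendsto_const_nhds ?_ ?_
  · filter_upwards [eventually_gt_atTop 0] with n hn
    have hn' : (0 : ℝ) < n := by exact_mod_cast hn
    have h1 : (n : ℝ) ≤ 2 * (((n : ℤ) / 2 : ℤ) : ℝ) + 1 := by
      have : (n : ℤ) ≤ 2 * ((n : ℤ) / 2) + 1 := by omega
      exact_mod_cast this
    rw [le_div_iff₀ hn']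
    field_simp
    linarith
  · filter_upwards [eventually_gt_atTop 0] with n hn
    have hn' : (0 : ℝ) < n := by exact_mod_cast hn
    have h1 : 2 * (((n : ℤ) / 2 : ℤ) : ℝ) ≤ n := by
      have : 2 * ((n : ℤ) / 2) ≤ n := by omega
      exact_mod_cast this
    rw [div_le_iff₀ hn']
    linarith

open Filter Topology in
theorem tendsto_const_div_natCast (c : ℝ) : Tendsto (fun n : ℕ => c / (n : ℝ)) atTop (𝓝 0) :=
  tendsto_const_div_atTop_nhds_zero_nat c

open Filter Topology in
theorem tendsto_upper_ratio (t : ℤ) :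
    Tendsto (fun n : ℕ => ((n : ℝ) - ((((n : ℤ) / 2 : ℤ) : ℝ) + t)) /
      ((((n : ℤ) / 2 : ℤ) : ℝ) + t + 1)) atTop (𝓝 1) := by
  have h1 := tendsto_int_half_div.add (tendsto_const_div_natCast t)
  have h2 := (h1.const_sub 1).div (h1.add (tendsto_const_div_natCast 1)) (by norm_num)
  norm_num at h2
  refine h2.congr' ?_
  filter_upwards [eventually_gt_atTop 0] with n hn
  have hn' : (n : ℝ) ≠ 0 := by positivity
  rw [Pi.div_apply]
  refine (mul_div_mul_right _ _ hn').symm.trans ?_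
  congr 1 <;> field_simp

open Filter Topology in
theorem tendsto_lower_ratio (m : ℕ) (t : ℤ) :
    Tendsto (fun n : ℕ => ((n : ℝ) - m - ((((n : ℤ) / 2 : ℤ) : ℝ) + t)) /
      ((n : ℝ) - m)) atTop (𝓝 (1 / 2)) := by
  have h1 := tendsto_int_half_div.add (tendsto_const_div_natCast t)
  have h3 := (tendsto_const_div_natCast m).const_sub 1
  have h2 := (h3.sub h1).div h3 (by norm_num)
  rw [sub_zero, add_zero, div_one, show (1 : ℝ) - 1 / 2 = 1 / 2 by norm_num] at h2
  refine h2.congr' ?_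
  filter_upwards [eventually_gt_atTop 0] with n hn
  have hn' : (n : ℝ) ≠ 0 := by positivity
  rw [Pi.div_apply]
  refine (mul_div_mul_right _ _ hn').symm.trans ?_
  congr 1 <;> field_simp

theorem choose_middle_pos (n : ℕ) : (0 : ℝ) < n.choose (n / 2) := by
  exact_mod_cast Nat.choose_pos (Nat.div_le_self n 2)

-- Neighbouring coefficients have ratio (x - y)/(y + 1) → 1, so the limit spreads from t = 0 in both
-- directions.
open Filter Topology in
theorem tendsto_intChoose_zero_div (t : ℤ) :
    Tendsto (fun n : ℕ => (intChoose n ((n : ℤ) / 2 + t) : ℝ) / n.choose (n / 2)) atTop (𝓝 1) := by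
  have key : ∀ t : ℤ, ∀ᶠ n : ℕ in atTop,
      0 < (n : ℝ) - ((((n : ℤ) / 2 : ℤ) : ℝ) + t) ∧ 0 < ((((n : ℤ) / 2 : ℤ) : ℝ) + t + 1) ∧
      (intChoose n ((n : ℤ) / 2 + (t + 1)) : ℝ) * ((((n : ℤ) / 2 : ℤ) : ℝ) + t + 1) =
        intChoose n ((n : ℤ) / 2 + t) * ((n : ℝ) - ((((n : ℤ) / 2 : ℤ) : ℝ) + t)) := by
    intro t
    filter_upwards [eventually_gt_atTop (2 * t.natAbs + 2)] with n hn
    have h1 := intChoose_add_one_mul (x := n) (y := (n : ℤ) / 2 + t) (by omega) (by omega)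
    rw [add_assoc ((n : ℤ) / 2)] at h1
    have h2 : 0 < (n : ℤ) - ((n : ℤ) / 2 + t) := by omega
    have h3 : 0 < (n : ℤ) / 2 + t + 1 := by omega
    refine ⟨by exact_mod_cast h2, by exact_mod_cast h3, ?_⟩
    rw [add_assoc (_ : ℝ)]
    exact_mod_cast h1
  have up : ∀ t : ℤ, Tendsto (fun n : ℕ => (intChoose n ((n : ℤ) / 2 + t) : ℝ) /
      n.choose (n / 2)) atTop (𝓝 1) → Tendsto (fun n : ℕ =>
      (intChoose n ((n : ℤ) / 2 + (t + 1)) : ℝ) / n.choose (n / 2)) atTop (𝓝 1) := by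
    intro t ht
    have := ht.mul (tendsto_upper_ratio t)
    rw [mul_one] at this
    refine this.congr' ?_
    filter_upwards [key t] with n ⟨_, h2, h3⟩
    have := choose_middle_pos n
    field_simp
    linarith
  have down : ∀ t : ℤ, Tendsto (fun n : ℕ => (intChoose n ((n : ℤ) / 2 + (t + 1)) : ℝ) /
      n.choose (n / 2)) atTop (𝓝 1) → Tendsto (fun n : ℕ =>
      (intChoose n ((n : ℤ) / 2 + t) : ℝ) / n.choose (n / 2)) atTop (𝓝 1) := by
    intro t ht
    have := ht.div (tendsto_upper_ratio t) one_ne_zero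
    rw [div_one] at this
    refine this.congr' ?_
    filter_upwards [key t] with n ⟨h1, h2, h3⟩
    have := choose_middle_pos n
    rw [Pi.div_apply]
    field_simp
    linarith
  induction t using Int.induction_on with
  | zero =>
    refine tendsto_const_nhds.congr fun n => ?_
    rw [add_zero, show ((n : ℤ) / 2) = ((n / 2 : ℕ) : ℤ) by simp, intChoose_natCast,
      div_self (choose_middle_pos n).ne']
  | succ t ih => exact up _ ih
  | pred t ih =>
    refine down _ ?_
    rwa [sub_add_cancel]

-- Lowering the upper index by one multiplies the coefficient by (x - y)/x → 1/2.
open Filter Topology in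
theorem tendsto_intChoose_div (m : ℕ) (t : ℤ) :
    Tendsto (fun n : ℕ => (intChoose ((n : ℤ) - m) ((n : ℤ) / 2 + t) : ℝ) / n.choose (n / 2))
      atTop (𝓝 ((1 / 2) ^ m)) := by
  induction m with
  | zero => simpa using tendsto_intChoose_zero_div t
  | succ m ih =>
    have := ih.mul (tendsto_lower_ratio m t)
    rw [← pow_succ] at this
    refine this.congr' ?_
    filter_upwards [eventually_gt_atTop m] with n hn
    have h1 := intChoose_sub_one_mul (x := (n : ℤ) - m) (y := (n : ℤ) / 2 + t) (by omega)
    rw [sub_sub] at h1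
    have h2 : (intChoose ((n : ℤ) - (m + 1 : ℕ)) ((n : ℤ) / 2 + t) : ℝ) * ((n : ℝ) - m) =
        intChoose ((n : ℤ) - m) ((n : ℤ) / 2 + t) *
          ((n : ℝ) - m - ((((n : ℤ) / 2 : ℤ) : ℝ) + t)) := by
      exact_mod_cast h1
    have h3 : (0 : ℝ) < (n : ℝ) - m := by
      rw [sub_pos]
      exact_mod_cast hn
    have := choose_middle_pos n
    field_simp
    linarith

-- By parity of n, ⌊(n - r)/2⌋ is ⌊n/2⌋ minus one of two constants; both shifts have the same limit,
-- so every neighbourhood is eventually entered in either case.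
open Filter Topology in
theorem tendsto_intChoose_shift_div (m r : ℕ) (t : ℤ) :
    Tendsto (fun n : ℕ => (intChoose ((n : ℤ) - m) (t + ((n : ℤ) - r) / 2) : ℝ) /
      n.choose (n / 2)) atTop (𝓝 ((1 / 2) ^ m)) := by
  refine tendsto_def.2 fun U hU => ?_
  filter_upwards [tendsto_def.1 (tendsto_intChoose_div m (t - (r : ℤ) / 2)) U hU,
    tendsto_def.1 (tendsto_intChoose_div m (t - ((r : ℤ) + 1) / 2)) U hU] with n h1 h2
  rw [Set.mem_preimage] at h1 h2 ⊢
  rcases (by omega : t + ((n : ℤ) - r) / 2 = (n : ℤ) / 2 + (t - (r : ℤ) / 2) ∨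
    t + ((n : ℤ) - r) / 2 = (n : ℤ) / 2 + (t - ((r : ℤ) + 1) / 2)) with h | h
  · rw [h]
    exact h1
  · rw [h]
    exact h2

/-! ### Asymptotics of `fp` and `Sp` -/

/-- The sum of the terms of `fp p r a b n` with `i < K`. -/
def fpPartial (p : ℤ) (r a b K n : ℕ) : ℕ :=
  ∑ i ∈ Finset.range K, ∑ v ∈ (extremalIndices r a b).piAntidiag i,
    Nat.multinomial (extremalIndices r a b) v *
      intChoose ((n : ℤ) - ((i : ℤ) + 1) * (r : ℤ))
        (p + ((n : ℤ) - (r : ℤ)) / 2 - ∑ j ∈ extremalIndices r a b, (j : ℤ) * (v j : ℤ)) *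
      ∏ j ∈ extremalIndices r a b, r.choose j ^ v j

theorem fpPartial_le_fp (p : ℤ) (r a b : ℕ) {K n : ℕ} (h : K ≤ n / r) :
    fpPartial p r a b K n ≤ fp p r a b n :=
  Finset.sum_le_sum_of_subset (Finset.range_subset_range.2 h)

-- With K fixed the number of terms is fixed, so limits are taken termwise; the shift by p and v
-- does not affect them, and the sum over v collapses to a power.
open Filter Topology in
theorem tendsto_fpPartial_div (p : ℤ) (r a b K : ℕ) :
    Tendsto (fun n : ℕ => (fpPartial p r a b K n : ℝ) / n.choose (n / 2)) atTop
      (𝓝 (∑ i ∈ Finset.range K,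
        (∑ j ∈ extremalIndices r a b, (r.choose j : ℝ)) ^ i * (1 / 2) ^ ((i + 1) * r))) := by
  simp only [fpPartial, Nat.cast_sum, Finset.sum_div, Finset.sum_pow_eq_sum_piAntidiag,
    Finset.sum_mul]
  refine tendsto_finsetSum _ fun i _ => tendsto_finsetSum _ fun v _ => ?_
  have h := (tendsto_intChoose_shift_div ((i + 1) * r) r
    (p - ∑ j ∈ extremalIndices r a b, (j : ℤ) * (v j : ℤ))).const_mul
    ((Nat.multinomial (extremalIndices r a b) v : ℝ) *
      ∏ j ∈ extremalIndices r a b, (r.choose j : ℝ) ^ v j)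
  refine h.congr fun n => ?_
  rw [sub_add_eq_add_sub]
  push_cast
  ring

open Finset in
theorem card_FSP_add_sum_choose (r a b : ℕ) :
    Fintype.card (FSP r a b) + ∑ j ∈ extremalIndices r a b, r.choose j = 2 ^ r := by
  have h1 : Fintype.card (FSP r a b) =
      ∑ j ∈ range (r + 1), if a < j ∧ j < b then r.choose j else 0 := by
    rw [Fintype.card_subtype, card_filter, ← powerset_univ,
      sum_powerset_apply_card (fun j => if a < j ∧ j < b then 1 else 0), card_univ,
      Fintype.card_fin]
    simp
  rw [h1, extremalIndices, sum_filter, ← sum_add_distrib, ← Nat.sum_range_choose]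
  refine sum_congr rfl fun j _ => ?_
  by_cases hj : a < j ∧ j < b
  · rw [if_pos hj, if_neg (by omega), add_zero]
  · rw [if_neg hj, if_pos (by omega), zero_add]

-- The ratio c/2^r is below 1 because N > 0, and 2^(-r)/(1 - c/2^r) = 1/(2^r - c) = 1/N.
open Filter Topology in
theorem tendsto_geometric_partial (r a b : ℕ) [Nonempty (FSP r a b)] :
    Tendsto (fun K => ∑ i ∈ Finset.range K,
      (∑ j ∈ extremalIndices r a b, (r.choose j : ℝ)) ^ i * (1 / 2) ^ ((i + 1) * r)) atTop
      (𝓝 (1 / (Fintype.card (FSP r a b) : ℝ))) := by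
  have hsum : (Fintype.card (FSP r a b) : ℝ) +
      ∑ j ∈ extremalIndices r a b, (r.choose j : ℝ) = 2 ^ r := by
    exact_mod_cast card_FSP_add_sum_choose r a b
  have hN : (0 : ℝ) < Fintype.card (FSP r a b) := by exact_mod_cast Fintype.card_pos
  have hc : (0 : ℝ) ≤ ∑ j ∈ extremalIndices r a b, (r.choose j : ℝ) := by positivity
  generalize ∑ j ∈ extremalIndices r a b, (r.choose j : ℝ) = c at *
  generalize (Fintype.card (FSP r a b) : ℝ) = N at *
  have h2 : (0 : ℝ) < 2 ^ r := by positivity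
  have h := ((hasSum_geometric_of_lt_one (r := c / 2 ^ r) (by positivity)
    (by rw [div_lt_one h2]; linarith)).mul_left (1 / 2 ^ r)).tendsto_sum_nat
  have hlim : 1 / 2 ^ r * (1 - c / 2 ^ r)⁻¹ = 1 / N := by
    rw [one_sub_div h2.ne', ← hsum, add_sub_cancel_right, inv_div, hsum]
    field_simp
  rw [hlim] at h
  refine h.congr fun K => Finset.sum_congr rfl fun i _ => ?_
  rw [add_mul, pow_add, mul_comm i r, pow_mul, one_mul, div_pow, div_pow, div_pow, ← pow_mul,
    one_pow, one_pow]
  field_simp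

open Filter in
theorem eventually_lt_fp_div {r a b : ℕ} (hr : 0 < r) [Nonempty (FSP r a b)] (p : ℤ) {x : ℝ}
    (hx : x < 1 / (Fintype.card (FSP r a b) : ℝ)) :
    ∀ᶠ n : ℕ in atTop, x < (fp p r a b n : ℝ) / n.choose (n / 2) := by
  obtain ⟨K, hK⟩ := ((tendsto_geometric_partial r a b).eventually_const_lt hx).exists
  filter_upwards [(tendsto_fpPartial_div p r a b K).eventually_const_lt hK,
    eventually_ge_atTop (K * r)] with n hn hKn
  refine hn.trans_le ?_
  gcongr
  exact fpPartial_le_fp p r a b ((Nat.le_div_iff_mul_le hr).2 hKn)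

open Filter in
theorem eventually_Sp_div_lt (U : Type*) [PartialOrder U] [Fintype U] [Nonempty U] {x : ℝ}
    (hx : 1 / (Fintype.card U : ℝ) < x) :
    ∀ᶠ n : ℕ in atTop, (Sp U n : ℝ) / n.choose (n / 2) < x := by
  have hN : (0 : ℝ) < Fintype.card U := by exact_mod_cast Fintype.card_pos
  -- (1 - 4N/n) x N tends to x N > 1, so it eventually exceeds 1, which absorbs the loss in
  -- `Sp_mul_card_le`.
  have h1 := ((tendsto_const_div_natCast (4 * Fintype.card U)).const_sub 1).mul_const
    (x * Fintype.card U)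
  rw [sub_zero, one_mul] at h1
  have h2 : 1 < x * Fintype.card U := (div_lt_iff₀ hN).1 hx
  filter_upwards [h1.eventually_const_lt h2, eventually_gt_atTop (4 * Fintype.card U)] with n hn hn'
  have hM := choose_middle_pos n
  have hn0 : (0 : ℝ) < n := by exact_mod_cast (Nat.zero_le _).trans_lt hn'
  have hpos : (0 : ℝ) < n - 4 * Fintype.card U := by
    rw [sub_pos]
    exact_mod_cast hn'
  have h3 : ((n : ℝ) - 4 * Fintype.card U) * (Sp U n * Fintype.card U) ≤ n * n.choose (n / 2) := by
    have := Sp_mul_card_le U n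
    rw [← Nat.cast_le (α := ℝ)] at this
    push_cast [hn'.le] at this
    exact this
  have h4 : (n : ℝ) < (n - 4 * Fintype.card U) * (x * Fintype.card U) := by
    have := mul_lt_mul_of_pos_left hn hn0
    rw [mul_one, ← mul_assoc, mul_sub, mul_one, mul_div_cancel₀ _ hn0.ne'] at this
    exact this
  rw [div_lt_iff₀ hM]
  have h5 := h3.trans_lt (mul_lt_mul_of_pos_right h4 hM)
  refine lt_of_mul_lt_mul_left (a := (n - 4 * Fintype.card U : ℝ) * Fintype.card U) ?_
    (by positivity)
  linarith

-- One squeeze that serves for `Sp`, for `fmax` (with p = 0) and for each `fp p`.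
open Filter Asymptotics in
theorem isEquivalent_of_le_Sp {r a b : ℕ} (hr : 0 < r) [Nonempty (FSP r a b)] (p : ℤ)
    {f : ℕ → ℕ} (hf : ∀ n, fp p r a b n ≤ f n) (hf' : ∀ n, f n ≤ Sp (FSP r a b) n) :
    IsEquivalent atTop (fun n => (f n : ℝ))
      (fun n => 1 / (Fintype.card (FSP r a b) : ℝ) * n.choose (n / 2)) := by
  have hN : (0 : ℝ) < 1 / Fintype.card (FSP r a b) := by
    have : (0 : ℝ) < Fintype.card (FSP r a b) := by exact_mod_cast Fintype.card_pos
    positivity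
  have hlim : Tendsto (fun n => (f n : ℝ) / n.choose (n / 2)) atTop
      (nhds (1 / (Fintype.card (FSP r a b) : ℝ))) := by
    refine tendsto_order.2 ⟨fun x hx => ?_, fun x hx => ?_⟩
    · filter_upwards [eventually_lt_fp_div hr p hx] with n hn
      refine hn.trans_le ?_
      gcongr
      exact hf n
    · filter_upwards [eventually_Sp_div_lt (FSP r a b) hx] with n hn
      refine lt_of_le_of_lt ?_ hn
      gcongr
      exact hf' n
  refine (isEquivalent_iff_tendsto_one (Eventually.of_forall fun n =>
    (mul_pos hN (choose_middle_pos n)).ne')).2 ?_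
  have := hlim.div_const (1 / (Fintype.card (FSP r a b) : ℝ))
  rw [div_self hN.ne'] at this
  refine this.congr fun n => ?_
  rw [Pi.div_apply, div_div, mul_comm]

theorem fmax_le_Sp {r a b : ℕ} (hab : a + 2 ≤ b) (hbr : b ≤ r) (n : ℕ) :
    fmax r a b n ≤ Sp (FSP r a b) n :=
  Finset.sup_le fun p _ => fp_le_Sp hab hbr p n

theorem fp_zero_le_fmax (r a b n : ℕ) : fp 0 r a b n ≤ fmax r a b n :=
  Finset.le_sup (f := fun p => fp p r a b n) (by simp)

theorem proposition3p3 (r a b : ℕ) (hr : 3 ≤ r) (hab : a + 2 ≤ b) (hbr : b ≤ r) :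
    Asymptotics.IsEquivalent Filter.atTop
        (fun n : ℕ => (fmax r a b n : ℝ)) (fun n : ℕ => (Sp (FSP r a b) n : ℝ)) ∧
      ∀ p : ℤ, Asymptotics.IsEquivalent Filter.atTop
        (fun n : ℕ => (fp p r a b n : ℝ)) (fun n : ℕ => (Sp (FSP r a b) n : ℝ)) := by
  have := nonempty_FSP hab hbr
  have hr0 : 0 < r := by omega
  have hSp := isEquivalent_of_le_Sp hr0 0 (fp_le_Sp hab hbr 0) fun n => le_rfl
  exact ⟨(isEquivalent_of_le_Sp hr0 0 (fp_zero_le_fmax r a b) (fmax_le_Sp hab hbr)).trans hSp.symm,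
    fun p => (isEquivalent_of_le_Sp hr0 p (fun n => le_rfl) (fp_le_Sp hab hbr p)).trans hSp.symm⟩
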